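/- Let $\mathbb{H}(n)$ be the real vector space of Hermitian complex $n\times n$ matrices and let $\mathbb{P}(n)\subset\mathbb{H}(n)$ be the open subset of positive definite matrices, regarded as a smooth manifold whose tangent space at every point is identified with $\mathbb{H}(n)$. For $\Sigma\in\mathbb{P}(n)$ and $H\in\mathbb{H}(n)$ let $\mathcal{L}_\Sigma(H)$ denote the unique complex $n\times n$ matrix $X$ with $\Sigma X+X\Sigma=H$. For $\Sigma,T\in\mathbb{P}(n)$ the number $\operatorname{tr}\Sigma+\operatorname{tr}T-2\operatorname{tr}\big((\Sigma^{1/2}T\Sigma^{1/2})^{1/2}\big)$ is real and nonnegative; let $$d^{BW}(\Sigma,T)=\Big[\operatorname{tr}\Sigma+\operatorname{tr}T-2\operatorname{tr}\big((\Sigma^{1/2}T\Sigma^{1/2})^{1/2}\big)\Big]^{1/2}$$ be the Bures–Wasserstein distance. Then $d^{BW}$ is a Riemannian distance, with the following corresponding metric: the formula $$\mathfrak{g}^{BW}_\Sigma(H,K)=\operatorname{Re}\operatorname{tr}\big(\mathcal{L}_\Sigma(H)\,\Sigma\,\mathcal{L}_\Sigma(K)\big)=\tfrac12\operatorname{Re}\operatorname{tr}\big(\mathcal{L}_\Sigma(H)\,K\big),\qquad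 \Sigma\in\mathbb{P}(n),\ H,K\in\mathbb{H}(n),$$ (in which the second equality always holds) defines a smooth Riemannian metric on $\mathbb{P}(n)$, and for all $\Sigma,T\in\mathbb{P}(n)$ the number $d^{BW}(\Sigma,T)$ is the infimum of the $\mathfrak{g}^{BW}$-lengths of the $C^1$ curves in $\mathbb{P}(n)$ from $\Sigma$ to $T$. -/

import Mathlib

open Bundle
open scoped Manifold ContDiff MatrixOrder ComplexOrder

noncomputable section

/-- The real vector space `ℍ(n)` of Hermitian complex `n × n` matrices. -/
def HermMat (n : ℕ) : Type :=
  selfAdjoint.submodule ℝ (Matrix (Fin n) (Fin n) ℂ)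

section Norm

attribute [local instance] Matrix.frobeniusNormedAddCommGroup Matrix.frobeniusNormedSpace

/-- The Frobenius norm on `ℍ(n)`. It serves only to make `ℍ(n)` a model space for manifolds;
its topology is the usual entrywise one. -/
instance HermMat.instNormedAddCommGroup (n : ℕ) : NormedAddCommGroup (HermMat n) :=
  inferInstanceAs (NormedAddCommGroup (selfAdjoint.submodule ℝ (Matrix (Fin n) (Fin n) ℂ)))

instance HermMat.instNormedSpace (n : ℕ) : NormedSpace ℝ (HermMat n) :=
  inferInstanceAs (NormedSpace ℝ (selfAdjoint.submodule ℝ (Matrix (Fin n) (Fin n) ℂ)))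

end Norm

/-- The inclusion of `ℍ(n)` into the complex `n × n` matrices. -/
def HermMat.toMat {n : ℕ} : HermMat n →ₗ[ℝ] Matrix (Fin n) (Fin n) ℂ :=
  (selfAdjoint.submodule ℝ (Matrix (Fin n) (Fin n) ℂ)).subtype

theorem HermMat.isHermitian {n : ℕ} (A : HermMat n) : (HermMat.toMat A).IsHermitian :=
  A.2

theorem HermMat.continuous_toMat (n : ℕ) :
    Continuous (HermMat.toMat : HermMat n → Matrix (Fin n) (Fin n) ℂ) :=
  continuous_subtype_val

theorem HermMat.isOpen_posDef (n : ℕ) :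
    IsOpen {A : HermMat n | (HermMat.toMat A).PosDef} := by
  have hset : {A : HermMat n | (HermMat.toMat A).PosDef} =
      {A : HermMat n | ∀ x ∈ Metric.sphere (0 : Fin n → ℂ) 1,
        0 < (star x ⬝ᵥ ((HermMat.toMat A).mulVec x)).re} := by
    ext A
    have hA : (HermMat.toMat A).IsHermitian := A.isHermitian
    simp only [Set.mem_ofPred_eq]
    constructor
    · intro h x hx
      have hx0 : x ≠ 0 := by
        rintro rfl
        simp at hx
      exact (Complex.pos_iff.1 (h.dotProduct_mulVec_pos hx0)).1
    · intro h
      refine Matrix.PosDef.of_dotProduct_mulVec_pos hA fun x hx => ?_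
      have him : (star x ⬝ᵥ ((HermMat.toMat A).mulVec x)).im = 0 := by
        simpa using hA.im_star_dotProduct_mulVec_self x
      refine Complex.pos_iff.2 ⟨?_, him.symm⟩
      have hn : (0 : ℝ) < ‖x‖ := norm_pos_iff.2 hx
      have h1 := h (((‖x‖⁻¹ : ℝ) : ℂ) • x) (by
        simp [norm_smul, hn.ne'])
      rw [star_smul, Matrix.mulVec_smul, smul_dotProduct, dotProduct_smul] at h1
      simp only [smul_eq_mul, Complex.star_def, Complex.conj_ofReal, Complex.re_ofReal_mul] at h1
      exact pos_of_mul_pos_right (pos_of_mul_pos_right h1 (inv_pos.2 hn).le) (inv_pos.2 hn).le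
  rw [hset, isOpen_iff_mem_nhds]
  intro A hA
  have hc : Continuous fun p : HermMat n × (Fin n → ℂ) =>
      (star p.2 ⬝ᵥ ((HermMat.toMat p.1).mulVec p.2)).re := by
    refine Complex.continuous_re.comp ?_
    refine Continuous.dotProduct (continuous_snd.star) ?_
    exact Continuous.matrix_mulVec ((HermMat.continuous_toMat n).comp continuous_fst) continuous_snd
  refine (isCompact_sphere (0 : Fin n → ℂ) 1).eventually_forall_of_forall_eventually ?_
  intro x hx
  exact hc.continuousAt.eventually (lt_mem_nhds (hA x hx))

/-- The manifold `ℙ(n)` of positive definite Hermitian matrices, an open subset of `ℍ(n)`. Its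
tangent space at every point is `ℍ(n)`. -/
def PosDefMat (n : ℕ) : TopologicalSpace.Opens (HermMat n) :=
  ⟨{A : HermMat n | (HermMat.toMat A).PosDef}, HermMat.isOpen_posDef n⟩

/-- The matrix underlying a point of `ℙ(n)`. -/
abbrev matOf {n : ℕ} (S : PosDefMat n) : Matrix (Fin n) (Fin n) ℂ :=
  HermMat.toMat (S : HermMat n)

/-- The Lyapunov operator `X ↦ Σ X + X Σ` on complex `n × n` matrices. -/
def lyapunovMap {n : ℕ} (S : PosDefMat n) :
    Matrix (Fin n) (Fin n) ℂ →ₗ[ℂ] Matrix (Fin n) (Fin n) ℂ :=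
  LinearMap.mulLeft ℂ (matOf S) + LinearMap.mulRight ℂ (matOf S)

theorem lyapunovMap_injective {n : ℕ} (S : PosDefMat n) :
    Function.Injective (lyapunovMap S) := by
  rw [injective_iff_map_eq_zero]
  intro X hX
  have hS : (matOf S).PosDef := S.2
  have hX' : (matOf S) * X + X * (matOf S) = 0 := hX
  have h1 := (hS.posSemidef.conjTranspose_mul_mul_same X).trace_nonneg
  have h2 := (hS.posSemidef.mul_mul_conjTranspose_same X).trace_nonneg
  have h3 : (X.conjTranspose * (matOf S) * X).trace + (X * (matOf S) * X.conjTranspose).trace = 0 := by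
    rw [Matrix.trace_mul_comm (X * (matOf S)), ← Matrix.trace_add, Matrix.mul_assoc, ← Matrix.mul_add,
      hX', Matrix.mul_zero, Matrix.trace_zero]
  have h4 : (X.conjTranspose * (matOf S) * X).trace = 0 :=
    ((add_eq_zero_iff_of_nonneg h1 h2).1 h3).1
  have h5 : X.conjTranspose * (matOf S) * X = 0 :=
    (hS.posSemidef.conjTranspose_mul_mul_same X).trace_eq_zero_iff.1 h4
  ext i j
  by_contra hne
  have hv : X.mulVec (Pi.single j 1) ≠ 0 := by
    intro h
    apply hne
    have := congrFun h i
    simpa using this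
  have hp := hS.dotProduct_mulVec_pos hv
  have h6 : star (X.mulVec (Pi.single j 1)) ⬝ᵥ ((matOf S).mulVec (X.mulVec (Pi.single j 1))) =
      star (Pi.single j (1 : ℂ)) ⬝ᵥ
        ((X.conjTranspose * (matOf S) * X).mulVec (Pi.single j 1)) := by
    simp only [Matrix.star_mulVec, Matrix.dotProduct_mulVec, Matrix.vecMul_vecMul, Matrix.mul_assoc]
  rw [h6, h5] at hp
  simp at hp

/-- `lyapunov S H` is the unique complex matrix `X` with `S X + X S = H`. -/
def lyapunov {n : ℕ} (S : PosDefMat n) :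
    Matrix (Fin n) (Fin n) ℂ →ₗ[ℂ] Matrix (Fin n) (Fin n) ℂ :=
  (LinearEquiv.ofInjectiveEndo (lyapunovMap S) (lyapunovMap_injective S)).symm.toLinearMap

/-- The complex number `tr Σ + tr T - 2 tr (Σ^{1/2} T Σ^{1/2})^{1/2}`, where `CFC.sqrt` is the
positive semidefinite square root of a positive semidefinite matrix. -/
def bwSq {n : ℕ} (S T : PosDefMat n) : ℂ :=
  (matOf S).trace + (matOf T).trace -
    2 * (CFC.sqrt (CFC.sqrt (matOf S) * matOf T * CFC.sqrt (matOf S))).trace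

/-- The Bures-Wasserstein distance, the square root of the (real and nonnegative) number
`bwSq S T`. -/
def bwDist {n : ℕ} (S T : PosDefMat n) : ℝ :=
  Real.sqrt (bwSq S T).re

/-- The Riemannian distance, in `[0, ∞]`, of a smooth Riemannian metric `g` on `ℙ(n)`: the infimum
of the `g`-lengths of the `C^1` curves joining the two points. -/
def riemDist {n : ℕ}
    (g : ContMDiffRiemannianMetric 𝓘(ℝ, HermMat n) ∞ (HermMat n)
      (fun S : PosDefMat n => TangentSpace 𝓘(ℝ, HermMat n) S))
    (S T : PosDefMat n) : ENNReal :=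
  letI : RiemannianBundle (fun S : PosDefMat n => TangentSpace 𝓘(ℝ, HermMat n) S) :=
    ⟨g.toRiemannianMetric⟩
  Manifold.riemannianEDist 𝓘(ℝ, HermMat n) S T

end

/-! For a positive definite `N` with `N T N = S`, let `A t = (1 - t) N + t` and
`M t = (A t)⁻¹ (1 - N)`. The curve `σ t = A t T A t` runs from `S` to `T` with `σ' = σ M + M σ`, so
`L_σ(σ') = M` and its speed is constant, with square
`tr (M σ M) = tr ((1 - N) T (1 - N)) = d(S, T)²`.

The function `X ↦ Re tr (M t X)` calibrates this curve. It increases by `d(S, T)²` from `(0, S)` to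
`(1, T)`, and `M' = -M²`. Hence along any curve `γ`, with `M` read at time `φ t`, its derivative is
`2 Re tr (M γ L_γ(γ')) - φ' Re tr (M γ M)`, which by the Cauchy–Schwarz and AM–GM inequalities is at
most `r² φ'` as soon as the speed of `γ` is at most `r φ'`. This gives `d(S, T) ≤ r`, and for every
`r` larger than the length of `γ` there is such a time change `φ` of `[0, 1]`. -/

noncomputable section

namespace BuresWasserstein

section Matrices

open Matrix RCLike

variable {ι 𝕜 : Type*} [Fintype ι] [RCLike 𝕜]

theorem re_trace_mul_mul_conjTranspose_pos {S X : Matrix ι ι 𝕜} (hS : S.PosDef) (hX : X ≠ 0) :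
    0 < re (X * S * Xᴴ).trace := by
  let := S.toMatrixNormedAddCommGroup hS
  let := S.toMatrixInnerProductSpace hS.posSemidef
  exact (re_inner_self_pos (𝕜 := 𝕜)).2 hX

theorem re_trace_mul_mul_conjTranspose_le {S : Matrix ι ι 𝕜} (hS : S.PosSemidef)
    (X Y : Matrix ι ι 𝕜) :
    re (X * S * Yᴴ).trace ≤ √(re (X * S * Xᴴ).trace) * √(re (Y * S * Yᴴ).trace) := by
  let := S.toMatrixSeminormedAddCommGroup hS
  let := S.toMatrixInnerProductSpace hS
  rw [mul_comm]
  exact re_inner_le_norm (𝕜 := 𝕜) Y X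

theorem re_trace_mul_anticommutator {S X Y : Matrix ι ι 𝕜} (hS : S.IsHermitian)
    (hX : X.IsHermitian) (hY : Y.IsHermitian) :
    re (X * (S * Y + Y * S)).trace = 2 * re (X * S * Y).trace := by
  have h : re (X * Y * S).trace = re (X * S * Y).trace := by
    rw [← conj_re, starRingEnd_apply, ← trace_conjTranspose, conjTranspose_mul, conjTranspose_mul,
      hS.eq, hX.eq, hY.eq, ← mul_assoc, trace_mul_cycle]
  rw [mul_add, trace_add, map_add, ← mul_assoc, ← mul_assoc, h, two_mul]

theorem isHermitian_anticommutator {S X : Matrix ι ι 𝕜} (hS : S.IsHermitian)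
    (hX : X.IsHermitian) : (S * X + X * S).IsHermitian := by
  rw [IsHermitian, conjTranspose_add, conjTranspose_mul, conjTranspose_mul, hS.eq, hX.eq, add_comm]

omit [Fintype ι] in
theorem convex_setOf_posDef : Convex ℝ {A : Matrix ι ι 𝕜 | A.PosDef} :=
  convex_iff_forall_pos.2 fun _ hA _ hB _ _ ha hb _ => (hA.smul ha).add (hB.smul hb)

theorem posDef_mul_mul_self {A S : Matrix ι ι 𝕜} (hA : A.PosDef) (hS : S.PosDef) :
    (A * S * A).PosDef := by
  classical
  simpa [star_eq_conjTranspose, hA.isHermitian.eq] using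
    (IsUnit.posDef_star_right_conjugate_iff hA.isUnit).2 hS

variable {S T : Matrix ι ι 𝕜}

open scoped Classical in
theorem posDef_sqrt (hS : S.PosDef) : (CFC.sqrt S).PosDef :=
  (IsStrictlyPositive.sqrt S hS.isStrictlyPositive).posDef

open scoped Classical in
theorem posDef_sqrt_mul_mul_sqrt (hS : S.PosDef) (hT : T.PosDef) :
    (CFC.sqrt S * T * CFC.sqrt S).PosDef :=
  posDef_mul_mul_self (posDef_sqrt hS) hT

variable [DecidableEq ι]

/-- The optimal transport map from the centered Gaussian with covariance `T` to the one with
covariance `S`: the positive definite solution `N` of `N T N = S`, see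
`transport_mul_mul_transport`. -/
def transport (S T : Matrix ι ι 𝕜) : Matrix ι ι 𝕜 :=
  CFC.sqrt S * (CFC.sqrt (CFC.sqrt S * T * CFC.sqrt S))⁻¹ * CFC.sqrt S

theorem posDef_transport (hS : S.PosDef) (hT : T.PosDef) : (transport S T).PosDef := by
  have hA := posDef_sqrt (posDef_sqrt_mul_mul_sqrt hS hT)
  exact posDef_mul_mul_self (posDef_sqrt hS) hA.inv

theorem transport_mul_mul_transport (hS : S.PosDef) (hT : T.PosDef) :
    transport S T * T * transport S T = S := by
  have hA := posDef_sqrt (posDef_sqrt_mul_mul_sqrt hS hT)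
  have hAA := CFC.sqrt_mul_sqrt_self _ (posDef_sqrt_mul_mul_sqrt hS hT).posSemidef.nonneg
  have hdet := (isUnit_iff_isUnit_det _).1 hA.isUnit
  rw [transport]
  set R := CFC.sqrt S with hR
  set A := CFC.sqrt (R * T * R)
  calc R * A⁻¹ * R * T * (R * A⁻¹ * R) = R * A⁻¹ * (R * T * R) * A⁻¹ * R := by
        simp only [mul_assoc]
    _ = R * (A⁻¹ * A) * (A * A⁻¹) * R := by rw [← hAA]; simp only [mul_assoc]
    _ = S := by
      rw [nonsing_inv_mul A hdet, mul_nonsing_inv A hdet, mul_one, mul_one, hR,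
        CFC.sqrt_mul_sqrt_self S hS.posSemidef.nonneg]

theorem trace_transport_mul (hS : S.PosDef) (hT : T.PosDef) :
    (transport S T * T).trace = (CFC.sqrt (CFC.sqrt S * T * CFC.sqrt S)).trace := by
  have hA := posDef_sqrt (posDef_sqrt_mul_mul_sqrt hS hT)
  have hAA := CFC.sqrt_mul_sqrt_self _ (posDef_sqrt_mul_mul_sqrt hS hT).posSemidef.nonneg
  have hdet := (isUnit_iff_isUnit_det _).1 hA.isUnit
  rw [transport]
  set R := CFC.sqrt S
  set A := CFC.sqrt (R * T * R)
  calc (R * A⁻¹ * R * T).trace = (A⁻¹ * (R * T * R)).trace := by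
        rw [mul_assoc, mul_assoc, trace_mul_comm]
        simp only [mul_assoc]
    _ = A.trace := by rw [← hAA, ← mul_assoc, nonsing_inv_mul A hdet, one_mul]

theorem trace_add_trace_sub_eq (hS : S.PosDef) (hT : T.PosDef) :
    S.trace + T.trace - 2 * (CFC.sqrt (CFC.sqrt S * T * CFC.sqrt S)).trace =
      ((1 - transport S T) * T * (1 - transport S T)).trace := by
  set N := transport S T
  have hexpand : (1 - N) * T * (1 - N) = N * T * N + T - (N * T + T * N) := by noncomm_ring
  rw [hexpand, transport_mul_mul_transport hS hT, trace_sub, trace_add, trace_add,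
    trace_mul_comm T N, trace_transport_mul hS hT, two_mul]

/-- McCann's displacement interpolation `(1 - t) N + t` from the transport map `N` to the
identity. -/
def displacement (N : Matrix ι ι 𝕜) (t : ℝ) : Matrix ι ι 𝕜 :=
  AffineMap.lineMap N 1 t

/-- The Bures–Wasserstein geodesic from `N T N` to `T`: the pushforward of the covariance `T` under
the displacement interpolation. -/
def geodesic (N T : Matrix ι ι 𝕜) (t : ℝ) : Matrix ι ι 𝕜 :=
  displacement N t * T * displacement N t

/-- The generator `M` of the geodesic `σ`, in the sense that `σ' = σ M + M σ`, see
`hasDerivAt_geodesic`. It depends on `N` only, and it is meaningful where `displacement N t` is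
invertible. -/
def momentum (N : Matrix ι ι 𝕜) (t : ℝ) : Matrix ι ι 𝕜 :=
  (displacement N t)⁻¹ * (1 - N)

variable {N : Matrix ι ι 𝕜} {t : ℝ}

omit [Fintype ι] in
theorem isHermitian_displacement (hN : N.IsHermitian) (t : ℝ) : (displacement N t).IsHermitian := by
  rw [displacement, AffineMap.lineMap_apply_module]
  exact (hN.smul (IsSelfAdjoint.all _)).add (isHermitian_one.smul (IsSelfAdjoint.all _))

omit [Fintype ι] in
theorem posDef_displacement (hN : N.PosDef) (ht : t ∈ Set.Icc 0 1) :
    (displacement N t).PosDef :=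
  (convex_setOf_posDef (ι := ι) (𝕜 := 𝕜)).lineMap_mem (Set.mem_ofPred.2 hN)
    (Set.mem_ofPred.2 PosDef.one) ht

theorem posDef_geodesic (hN : N.PosDef) (hT : T.PosDef) (ht : t ∈ Set.Icc 0 1) :
    (geodesic N T t).PosDef :=
  posDef_mul_mul_self (posDef_displacement hN ht) hT

theorem commute_displacement (N : Matrix ι ι 𝕜) (t : ℝ) : Commute (displacement N t) (1 - N) := by
  have hN : Commute N (1 - N) := (Commute.one_right N).sub_right (Commute.refl N)
  rw [displacement, AffineMap.lineMap_apply_module']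
  exact (((Commute.one_left _).sub_left hN).smul_left t).add_left hN

theorem displacement_mul_momentum (hA : IsUnit (displacement N t)) :
    displacement N t * momentum N t = 1 - N :=
  mul_nonsing_inv_cancel_left _ _ ((isUnit_iff_isUnit_det _).1 hA)

theorem momentum_mul_displacement (hA : IsUnit (displacement N t)) :
    momentum N t * displacement N t = 1 - N := by
  rw [momentum, mul_assoc, ← (commute_displacement N t).eq,
    nonsing_inv_mul_cancel_left _ _ ((isUnit_iff_isUnit_det _).1 hA)]

theorem isHermitian_momentum (hN : N.IsHermitian) (hA : IsUnit (displacement N t)) :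
    (momentum N t).IsHermitian := by
  have hcomm : (1 - N) * (displacement N t)⁻¹ = momentum N t := by
    rw [← momentum_mul_displacement hA,
      mul_nonsing_inv_cancel_right _ _ ((isUnit_iff_isUnit_det _).1 hA)]
  rw [IsHermitian, ← hcomm, conjTranspose_mul, (isHermitian_displacement hN t).inv.eq,
    (isHermitian_one.sub hN).eq, hcomm, momentum]

theorem trace_momentum_mul_geodesic_mul_momentum (hA : IsUnit (displacement N t)) :
    (momentum N t * geodesic N T t * momentum N t).trace = ((1 - N) * T * (1 - N)).trace := by
  rw [geodesic, ← mul_assoc, ← mul_assoc, momentum_mul_displacement hA,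
    mul_assoc _ _ (momentum N t), displacement_mul_momentum hA]

theorem geodesic_zero (N T : Matrix ι ι 𝕜) : geodesic N T 0 = N * T * N := by
  simp [geodesic, displacement]

theorem geodesic_one (N T : Matrix ι ι 𝕜) : geodesic N T 1 = T := by
  simp [geodesic, displacement]

theorem trace_momentum_mul_geodesic_one_sub_zero (T : Matrix ι ι 𝕜) (hN : IsUnit N) :
    (momentum N 1 * geodesic N T 1).trace - (momentum N 0 * geodesic N T 0).trace =
      ((1 - N) * T * (1 - N)).trace := by
  have h0 : displacement N 0 = N := AffineMap.lineMap_apply_zero N 1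
  have h1 : momentum N 1 = 1 - N := by simp [momentum, displacement]
  have hM : momentum N 0 * N = 1 - N := by
    rw [← momentum_mul_displacement (t := 0) (h0.symm ▸ hN), h0]
  rw [geodesic_zero, geodesic_one, h1, mul_assoc N, ← mul_assoc (momentum N 0), hM, ← mul_assoc,
    mul_sub _ 1, mul_one, trace_sub]

section Calculus

attribute [local instance] frobeniusNormedAddCommGroup frobeniusNormedSpace
  frobeniusNormedRing frobeniusNormedAlgebra

omit [DecidableEq ι] in
theorem hasDerivAt_re_trace {X : ℝ → Matrix ι ι 𝕜} {X' : Matrix ι ι 𝕜} {t : ℝ}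
    (hX : HasDerivAt X X' t) :
    HasDerivAt (fun s => re (X s).trace) (re X'.trace) t :=
  (reCLM.comp (traceLinearMap ι ℝ 𝕜).toContinuousLinearMap).hasFDerivAt.comp_hasDerivAt t hX

theorem contDiff_geodesic (N T : Matrix ι ι 𝕜) {k : WithTop ℕ∞} :
    ContDiff ℝ k (geodesic N T) := by
  unfold geodesic displacement
  simp only [AffineMap.lineMap_apply_module]
  fun_prop

theorem hasDerivAt_geodesic (hA : IsUnit (displacement N t)) :
    HasDerivAt (geodesic N T)
      (geodesic N T t * momentum N t + momentum N t * geodesic N T t) t := by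
  have hd : HasDerivAt (displacement N) (1 - N) t := AffineMap.hasDerivAt_lineMap
  refine ((hd.mul_const T).mul hd).congr_deriv ?_
  rw [geodesic, ← mul_assoc, ← mul_assoc, momentum_mul_displacement hA,
    mul_assoc _ _ (momentum N t), displacement_mul_momentum hA, add_comm]

-- This is the Hamilton–Jacobi equation, `M` being the Hessian of a quadratic potential.
theorem hasDerivAt_momentum (hA : IsUnit (displacement N t)) :
    HasDerivAt (momentum N) (-(momentum N t * momentum N t)) t := by
  have hd : HasDerivAt (displacement N) (1 - N) t := AffineMap.hasDerivAt_lineMap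
  have hinv : HasDerivAt (fun s => (displacement N s)⁻¹)
      (-((displacement N t)⁻¹ * (1 - N) * (displacement N t)⁻¹)) t := by
    obtain ⟨u, hu⟩ := hA
    simp only [nonsing_inv_eq_ringInverse]
    refine ((hu ▸ hasFDerivAt_ringInverse (𝕜 := ℝ) u).comp_hasDerivAt t hd).congr_deriv ?_
    simp [← hu]
  exact (hinv.mul_const (1 - N)).congr_deriv (by simp only [momentum, neg_mul, mul_assoc])

theorem continuousOn_momentum (hN : N.PosDef) : ContinuousOn (momentum N) (Set.Icc 0 1) :=
  fun _ ht =>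
    (hasDerivAt_momentum (posDef_displacement hN ht).isUnit).continuousAt.continuousWithinAt

theorem hasDerivAt_re_trace_momentum_mul {X : ℝ → Matrix ι ι 𝕜} {X' : Matrix ι ι 𝕜} {φ : ℝ → ℝ}
    {φ' t : ℝ} (hA : IsUnit (displacement N (φ t))) (hφ : HasDerivAt φ φ' t)
    (hX : HasDerivAt X X' t) :
    HasDerivAt (fun s => re (momentum N (φ s) * X s).trace)
      (re (momentum N (φ t) * X').trace -
        φ' * re (momentum N (φ t) * X t * momentum N (φ t)).trace) t := by
  refine (hasDerivAt_re_trace (((hasDerivAt_momentum hA).scomp t hφ).mul hX)).congr_deriv ?_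
  rw [smul_neg, neg_mul, smul_mul_assoc, trace_add, trace_neg, trace_smul, map_add, map_neg,
    smul_re, mul_assoc, trace_mul_comm, neg_add_eq_sub]
  rfl

end Calculus

end Matrices

section HermitianMatrices

open Matrix

instance (n : ℕ) : FiniteDimensional ℝ (HermMat n) :=
  inferInstanceAs (FiniteDimensional ℝ (selfAdjoint.submodule ℝ (Matrix (Fin n) (Fin n) ℂ)))

/-- `HermMat.toMat` as a continuous linear map. -/
def toMatL (n : ℕ) : HermMat n →L[ℝ] Matrix (Fin n) (Fin n) ℂ :=
  ⟨HermMat.toMat, HermMat.continuous_toMat n⟩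

/-- The Hermitian part `(A + Aᴴ) / 2` of a complex matrix. -/
def hermPart (n : ℕ) : Matrix (Fin n) (Fin n) ℂ →L[ℝ] HermMat n :=
  selfAdjointPartL ℝ (Matrix (Fin n) (Fin n) ℂ)

variable {n : ℕ}

theorem toMat_injective : Function.Injective (HermMat.toMat (n := n)) :=
  Subtype.val_injective

theorem toMat_hermPart {A : Matrix (Fin n) (Fin n) ℂ} (hA : A.IsHermitian) :
    (hermPart n A).toMat = A :=
  IsSelfAdjoint.coe_selfAdjointPart_apply ℝ hA

theorem lyapunov_spec (S : PosDefMat n) (H : Matrix (Fin n) (Fin n) ℂ) :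
    matOf S * lyapunov S H + lyapunov S H * matOf S = H :=
  (LinearEquiv.ofInjectiveEndo (lyapunovMap S) (lyapunovMap_injective S)).apply_symm_apply H

theorem lyapunov_eq {S : PosDefMat n} {H X : Matrix (Fin n) (Fin n) ℂ}
    (h : matOf S * X + X * matOf S = H) : lyapunov S H = X :=
  lyapunovMap_injective S ((lyapunov_spec S H).trans h.symm)

theorem isHermitian_lyapunov (S : PosDefMat n) {H : Matrix (Fin n) (Fin n) ℂ}
    (hH : H.IsHermitian) : (lyapunov S H).IsHermitian := by
  refine (lyapunov_eq ?_).symm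
  have h := congrArg conjTranspose (lyapunov_spec S H)
  rwa [conjTranspose_add, conjTranspose_mul, conjTranspose_mul, S.1.isHermitian.eq, hH.eq,
    add_comm] at h

/-- The anticommutator `S H + H S` on `ℍ(n)`. Unlike `lyapunovMap` it is linear in `S` as well,
and it is defined for every Hermitian `S`, so that its inverse `lyapunov` can be differentiated. -/
def anticommL (n : ℕ) : HermMat n →L[ℝ] HermMat n →L[ℝ] HermMat n :=
  let mulL := LinearMap.mul ℝ (Matrix (Fin n) (Fin n) ℂ)
  (((mulL + mulL.flip).compl₁₂ HermMat.toMat HermMat.toMat).compr₂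
    (hermPart n).toLinearMap).toContinuousBilinearMap

theorem toMat_anticommL (S H : HermMat n) :
    (anticommL n S H).toMat = S.toMat * H.toMat + H.toMat * S.toMat :=
  toMat_hermPart (isHermitian_anticommutator S.isHermitian H.isHermitian)

/-- The operator `lyapunov S` restricted to Hermitian matrices. -/
def lyapunovL (S : PosDefMat n) : HermMat n →L[ℝ] HermMat n :=
  ((hermPart n).toLinearMap ∘ₗ
    (lyapunov S).restrictScalars ℝ ∘ₗ HermMat.toMat).toContinuousLinearMap

theorem toMat_lyapunovL (S : PosDefMat n) (H : HermMat n) :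
    (lyapunovL S H).toMat = lyapunov S H.toMat :=
  toMat_hermPart (isHermitian_lyapunov S H.isHermitian)

theorem anticommL_comp_lyapunovL (S : PosDefMat n) :
    anticommL n S ∘L lyapunovL S = .id ℝ (HermMat n) := by
  ext1 H
  apply toMat_injective
  rw [ContinuousLinearMap.comp_apply, toMat_anticommL, toMat_lyapunovL, lyapunov_spec,
    ContinuousLinearMap.id_apply]

theorem lyapunovL_comp_anticommL (S : PosDefMat n) :
    lyapunovL S ∘L anticommL n S = .id ℝ (HermMat n) := by
  ext1 H
  apply toMat_injective
  rw [ContinuousLinearMap.comp_apply, toMat_lyapunovL, lyapunov_eq (toMat_anticommL _ _).symm,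
    ContinuousLinearMap.id_apply]

theorem contMDiff_lyapunovL {k : WithTop ℕ∞} :
    ContMDiff 𝓘(ℝ, HermMat n) 𝓘(ℝ, HermMat n →L[ℝ] HermMat n) k (lyapunovL (n := n)) := by
  have hinverse : lyapunovL = fun S : PosDefMat n => (anticommL n S).inverse := by
    funext S
    exact (ContinuousLinearMap.inverse_eq (anticommL_comp_lyapunovL S)
      (lyapunovL_comp_anticommL S)).symm
  have : CompleteSpace (HermMat n) := FiniteDimensional.complete ℝ (HermMat n)
  intro S
  rw [hinverse]
  have hS := ContinuousLinearMap.IsInvertible.of_inverse (anticommL_comp_lyapunovL S)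
    (lyapunovL_comp_anticommL S)
  have h : ContDiffAt ℝ k (fun H => (anticommL n H).inverse) (S : HermMat n) :=
    hS.contDiffAt_map_inverse.comp _ (anticommL n).contDiff.contDiffAt
  exact h.contMDiffAt.comp S contMDiff_subtype_val.contMDiffAt

/-- The trace form `Re tr (H K)` on `ℍ(n)`. -/
def traceForm (n : ℕ) : HermMat n →L[ℝ] HermMat n →L[ℝ] ℝ :=
  (((LinearMap.mul ℝ (Matrix (Fin n) (Fin n) ℂ)).compl₁₂ HermMat.toMat HermMat.toMat).compr₂
    (Complex.reLm ∘ₗ traceLinearMap (Fin n) ℝ ℂ)).toContinuousBilinearMap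

/-- The Bures–Wasserstein inner product `Re tr (L_S(H) K) / 2` on the tangent space `ℍ(n)` at
`S`. -/
def bwForm (S : PosDefMat n) : HermMat n →L[ℝ] HermMat n →L[ℝ] ℝ :=
  ((1 / 2 : ℝ) • traceForm n) ∘L lyapunovL S

theorem bwForm_apply (S : PosDefMat n) (H K : HermMat n) :
    bwForm S H K = 1 / 2 * (lyapunov S H.toMat * K.toMat).trace.re := by
  rw [← toMat_lyapunovL]
  rfl

theorem bwForm_eq_re_trace (S : PosDefMat n) (H K : HermMat n) :
    bwForm S H K = (lyapunov S H.toMat * matOf S * lyapunov S K.toMat).trace.re := by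
  have h := re_trace_mul_anticommutator S.1.isHermitian (isHermitian_lyapunov S H.isHermitian)
    (isHermitian_lyapunov S K.isHermitian)
  rw [lyapunov_spec] at h
  rw [bwForm_apply, ← RCLike.re_eq_complex_re, h]
  ring

theorem bwForm_comm (S : PosDefMat n) (H K : HermMat n) : bwForm S H K = bwForm S K H := by
  rw [bwForm_eq_re_trace, bwForm_eq_re_trace, ← Complex.conj_re, starRingEnd_apply,
    ← trace_conjTranspose, conjTranspose_mul, conjTranspose_mul, S.1.isHermitian.eq,
    (isHermitian_lyapunov S H.isHermitian).eq, (isHermitian_lyapunov S K.isHermitian).eq, mul_assoc]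

theorem bwForm_self_pos (S : PosDefMat n) {H : HermMat n} (hH : H ≠ 0) : 0 < bwForm S H H := by
  have hL : lyapunov S H.toMat ≠ 0 := fun h => hH <| toMat_injective <| by
    rw [← lyapunov_spec S H.toMat, h, mul_zero, zero_mul, add_zero, map_zero]
  have h := re_trace_mul_mul_conjTranspose_pos S.2 hL
  rw [(isHermitian_lyapunov S H.isHermitian).eq] at h
  rwa [bwForm_eq_re_trace]

theorem contMDiff_bwForm {k : WithTop ℕ∞} :
    ContMDiff 𝓘(ℝ, HermMat n) 𝓘(ℝ, HermMat n →L[ℝ] HermMat n →L[ℝ] ℝ) k (bwForm (n := n)) :=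
  contMDiff_const.clm_comp contMDiff_lyapunovL

end HermitianMatrices

section OpenSubset

open TopologicalSpace

theorem mem_chart_source_opens {H : Type*} [TopologicalSpace H] {U : Opens H} (x y : U) :
    y ∈ (chartAt H x).source := by
  rw [Opens.chartAt_eq, OpenPartialHomeomorph.subtypeRestr_source]
  exact Set.mem_univ _

variable {E : Type*} [NormedAddCommGroup E] [NormedSpace ℝ E] {U : Opens E}

theorem symmL_tangentBundle_opens (x y : U) :
    (trivializationAt E (TangentSpace 𝓘(ℝ, E)) x).symmL ℝ y = ContinuousLinearMap.id ℝ E := by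
  have hchart : achart E x = achart E y := Subtype.ext rfl
  rw [TangentBundle.symmL_trivializationAt_eq_core (mem_chart_source_opens x y), hchart]
  ext v
  exact (tangentBundleCore 𝓘(ℝ, E) U).coordChange_self (achart E y) y
    (mem_chart_source_opens y y) v

theorem contMDiff_bilinearForm_opens {k : WithTop ℕ∞}
    {f : ∀ x : U, TangentSpace 𝓘(ℝ, E) x →L[ℝ] TangentSpace 𝓘(ℝ, E) x →L[ℝ] ℝ}
    (hf : ContMDiff (M' := E →L[ℝ] E →L[ℝ] ℝ) 𝓘(ℝ, E) 𝓘(ℝ, E →L[ℝ] E →L[ℝ] ℝ) k f) :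
    ContMDiff 𝓘(ℝ, E) (𝓘(ℝ, E).prod 𝓘(ℝ, E →L[ℝ] E →L[ℝ] ℝ)) k
      (fun x : U => TotalSpace.mk' (E →L[ℝ] E →L[ℝ] ℝ) x (f x)) := by
  intro x
  rw [contMDiffAt_section]
  refine (hf x).congr_of_eventuallyEq (.of_forall fun y =>
    ContinuousLinearMap.ext fun v => ContinuousLinearMap.ext fun w => ?_)
  have hy : y ∈ (trivializationAt E (TangentSpace 𝓘(ℝ, E)) x).baseSet :=
    mem_chart_source_opens x y
  have hsymm (v : E) : (trivializationAt E (TangentSpace 𝓘(ℝ, E)) x).symm y v = v := by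
    rw [← Trivialization.symmL_apply (R := ℝ) _ hy]
    exact DFunLike.congr_fun (symmL_tangentBundle_opens x y) v
  have hcoord := inCoordinates_apply_eq₂ (F₃ := ℝ) (E₃ := Bundle.Trivial U ℝ) (x₀ := x)
    (ϕ := f y) (v := v) (w := w) hy hy (Set.mem_univ _)
  rw [hsymm v, hsymm w] at hcoord
  exact hcoord.trans (DFunLike.congr_fun (Trivial.linearMapAt_trivialization ℝ U ℝ y) (f y v w))

theorem hasMFDerivAt_subtype_val_opens (x : U) :
    HasMFDerivAt 𝓘(ℝ, E) 𝓘(ℝ, E) (Subtype.val : U → E) x (ContinuousLinearMap.id ℝ E) := by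
  refine ⟨continuous_subtype_val.continuousAt, ?_⟩
  have h : writtenInExtChartAt 𝓘(ℝ, E) 𝓘(ℝ, E) x (Subtype.val : U → E) =ᶠ[nhds (x : E)] id :=
    (U.chartAt_subtype_val_symm_eventuallyEq (H := E) (x := x)).symm
  exact ((hasFDerivAt_id (x : E)).congr_of_eventuallyEq h).hasFDerivWithinAt

variable {γ : ℝ → U} {s : Set ℝ}

theorem hasDerivWithinAt_coe_opens {t : ℝ}
    (hγ : MDifferentiableWithinAt 𝓘(ℝ, ℝ) 𝓘(ℝ, E) γ s t) :
    HasDerivWithinAt (F := E) (fun u => (γ u : E))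
      (mfderivWithin 𝓘(ℝ, ℝ) 𝓘(ℝ, E) γ s t (1 : ℝ) : E) s t := by
  have h := (hasMFDerivAt_subtype_val_opens (γ t)).comp_hasMFDerivWithinAt t hγ.hasMFDerivWithinAt
  have h' : HasFDerivWithinAt (F := E) (fun u => (γ u : E))
      ((ContinuousLinearMap.id ℝ E).comp (mfderivWithin 𝓘(ℝ, ℝ) 𝓘(ℝ, E) γ s t : ℝ →L[ℝ] E)) s t :=
    hasMFDerivWithinAt_iff_hasFDerivWithinAt.1 h
  exact h'.hasDerivWithinAt

theorem contDiffOn_coe_opens {k : WithTop ℕ∞} (hγ : ContMDiffOn 𝓘(ℝ, ℝ) 𝓘(ℝ, E) k γ s) :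
    ContDiffOn ℝ k (fun t => (γ t : E)) s :=
  contMDiffOn_iff_contDiffOn.1 (contMDiff_subtype_val.comp_contMDiffOn hγ)

theorem exists_contMDiffOn_lift_opens [Nonempty U] {k : WithTop ℕ∞} {c : ℝ → E}
    (hc : ContDiffOn ℝ k c s) (hU : ∀ t ∈ s, c t ∈ U) :
    ∃ γ : ℝ → U, ContMDiffOn 𝓘(ℝ, ℝ) 𝓘(ℝ, E) k γ s ∧ ∀ t ∈ s, (γ t : E) = c t := by
  classical
  let γ : ℝ → U := fun t => if h : c t ∈ U then ⟨c t, h⟩ else Classical.arbitrary U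
  have hγ (t : ℝ) (ht : t ∈ s) : (γ t : E) = c t := congrArg Subtype.val (dif_pos (hU t ht))
  have hcoe : ContMDiffOn 𝓘(ℝ, ℝ) 𝓘(ℝ, E) k (Subtype.val ∘ γ) s := hc.contMDiffOn.congr hγ
  exact ⟨γ, fun t ht => (ChartedSpace.liftPropWithinAt_subtypeVal_comp_iff ..).1 (hcoe t ht), hγ⟩

end OpenSubset

section Coercive

variable {E : Type*} [NormedAddCommGroup E] [NormedSpace ℝ E] {B : E →L[ℝ] E →L[ℝ] ℝ}

theorem isCoercive_of_pos [FiniteDimensional ℝ E] (hB : ∀ v, v ≠ 0 → 0 < B v v) :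
    IsCoercive B := by
  have : ProperSpace E := FiniteDimensional.proper ℝ E
  rcases subsingleton_or_nontrivial E with _ | _
  · exact ⟨1, one_pos, fun v => by simp [Subsingleton.elim v 0]⟩
  have hcont : Continuous fun v => B v v := B.continuous.clm_apply continuous_id
  obtain ⟨u, hu, hmin⟩ := (isCompact_sphere (0 : E) 1).exists_isMinOn
    (NormedSpace.sphere_nonempty.2 zero_le_one) hcont.continuousOn
  refine ⟨B u u, hB u (ne_zero_of_mem_unit_sphere ⟨u, hu⟩), fun v => ?_⟩
  rcases eq_or_ne v 0 with rfl | hv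
  · simp
  have hv' : ‖v‖ ≠ 0 := norm_ne_zero_iff.2 hv
  have hle : B u u ≤ ‖v‖⁻¹ * (‖v‖⁻¹ * B v v) := by
    simpa using hmin (show ‖v‖⁻¹ • v ∈ Metric.sphere (0 : E) 1 by simp [norm_smul, hv'])
  calc B u u * ‖v‖ * ‖v‖ ≤ ‖v‖⁻¹ * (‖v‖⁻¹ * B v v) * ‖v‖ * ‖v‖ := by gcongr
    _ = B v v := by field_simp

theorem isVonNBounded_of_isCoercive (hB : IsCoercive B) :
    Bornology.IsVonNBounded ℝ {v : E | B v v < 1} := by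
  obtain ⟨C, hC, hle⟩ := hB
  rw [NormedSpace.isVonNBounded_iff]
  refine (Metric.isBounded_closedBall (x := (0 : E)) (r := √(1 / C))).subset fun v hv => ?_
  rw [mem_closedBall_zero_iff]
  refine Real.le_sqrt_of_sq_le ((le_div_iff₀ hC).2 ?_)
  calc ‖v‖ ^ 2 * C = C * ‖v‖ * ‖v‖ := by ring
    _ ≤ 1 := (hle v).trans hv.le

end Coercive

section Clock

open MeasureTheory intervalIntegral

/-- A time change `φ` of `[0, 1]` with derivative `φ'` on `(0, 1)` after which a motion of speed `v`
has speed at most `r`, written `v ≤ r φ'` to allow `φ' = 0`. -/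
structure IsClock (v : ℝ → ℝ) (r : ℝ) (φ φ' : ℝ → ℝ) : Prop where
  zero : φ 0 = 0
  one : φ 1 = 1
  continuousOn : ContinuousOn φ (Set.Icc 0 1)
  hasDerivAt : ∀ t ∈ Set.Ioo 0 1, HasDerivAt φ (φ' t) t
  le : ∀ t ∈ Set.Ioo 0 1, v t ≤ r * φ' t

variable {v φ φ' : ℝ → ℝ} {r : ℝ}

theorem IsClock.mapsTo (h : IsClock v r φ φ') (hv : ∀ t, 0 ≤ v t) (hr : 0 < r) :
    Set.MapsTo φ (Set.Icc 0 1) (Set.Icc 0 1) := by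
  have hmono : MonotoneOn φ (Set.Icc 0 1) := by
    refine monotoneOn_of_hasDerivWithinAt_nonneg (f' := φ') (convex_Icc 0 1) h.continuousOn
      (fun t ht => ?_) (fun t ht => ?_) <;> rw [interior_Icc] at ht
    · exact (h.hasDerivAt t ht).hasDerivWithinAt
    · exact nonneg_of_mul_nonneg_right ((hv t).trans (h.le t ht)) hr
  simpa only [h.zero, h.one] using hmono.mapsTo_Icc

theorem exists_isClock (hv : ContinuousOn v (Set.Icc 0 1)) (hr : 0 < r)
    (hvr : ∫ t in 0..1, v t ≤ r) : ∃ φ φ', IsClock v r φ φ' := by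
  let ℓ := ∫ t in 0..1, v t
  have hint : IntervalIntegrable v volume 0 1 := hv.intervalIntegrable_of_Icc zero_le_one
  refine ⟨fun t => ((∫ s in 0..t, v s) + (r - ℓ) * t) / r, fun t => (v t + (r - ℓ)) / r,
    by simp, ?_, ?_, fun t ht => ?_, fun t _ => ?_⟩
  · simp only [mul_one, ℓ, add_sub_cancel, div_self hr.ne']
  · have hprim := continuousOn_primitive_interval' hint Set.left_mem_uIcc
    rw [Set.uIcc_of_le zero_le_one] at hprim
    fun_prop
  · have hint_t : IntervalIntegrable v volume 0 t :=
      (hv.mono (Set.Icc_subset_Icc_right ht.2.le)).intervalIntegrable_of_Icc ht.1.le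
    have hmeas : StronglyMeasurableAtFilter v (nhds t) :=
      (hv.mono Set.Ioo_subset_Icc_self).stronglyMeasurableAtFilter isOpen_Ioo t ht
    have hprim := integral_hasDerivAt_right hint_t hmeas
      (hv.continuousAt (Icc_mem_nhds ht.1 ht.2))
    exact (hprim.add (hasDerivAt_const_mul (r - ℓ))).div_const r
  · rw [mul_div_cancel₀ _ hr.ne']
    linarith

end Clock

section Distance

open Matrix

variable {n : ℕ}

theorem bwSq_eq_trace (S T : PosDefMat n) :
    bwSq S T = ((1 - transport (matOf S) (matOf T)) * matOf T *
      (1 - transport (matOf S) (matOf T))).trace :=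
  trace_add_trace_sub_eq S.2 T.2

theorem bwSq_nonneg (S T : PosDefMat n) : 0 ≤ bwSq S T := by
  have h := (T.2.posSemidef.mul_mul_conjTranspose_same
    (1 - transport (matOf S) (matOf T))).trace_nonneg
  rwa [(isHermitian_one.sub (posDef_transport S.2 T.2).isHermitian).eq, ← bwSq_eq_trace] at h

theorem sq_bwDist (S T : PosDefMat n) : bwDist S T ^ 2 = (bwSq S T).re :=
  Real.sq_sqrt (Complex.nonneg_iff.1 (bwSq_nonneg S T)).1

/-- The Bures–Wasserstein metric. -/
def bwMetric (n : ℕ) : ContMDiffRiemannianMetric 𝓘(ℝ, HermMat n) ∞ (HermMat n)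
    (fun S : PosDefMat n => TangentSpace 𝓘(ℝ, HermMat n) S) where
  inner S := bwForm S
  symm := bwForm_comm
  pos S _ := bwForm_self_pos S
  isVonNBounded S :=
    isVonNBounded_of_isCoercive (E := HermMat n) (isCoercive_of_pos fun _ => bwForm_self_pos S)
  contMDiff := contMDiff_bilinearForm_opens contMDiff_bwForm

/-- The norm on the tangent spaces of `ℙ(n)` given by `bwMetric`, as an instance to be used
locally. -/
@[reducible]
def bwBundle (n : ℕ) :
    RiemannianBundle (fun S : PosDefMat n => TangentSpace 𝓘(ℝ, HermMat n) S) :=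
  ⟨(bwMetric n).toRiemannianMetric⟩

attribute [local instance] bwBundle

theorem enorm_tangentSpace_eq (S : PosDefMat n) (H : TangentSpace 𝓘(ℝ, HermMat n) S) :
    ‖H‖ₑ = ENNReal.ofReal √(bwForm S H H) := by
  rw [← ofReal_norm, norm_eq_sqrt_real_inner]
  rfl

/-- The Bures–Wasserstein speed of a curve parametrized by `[0, 1]`. The derivative is taken within
`[0, 1]`, so that the speed is continuous up to the end points. -/
def speed (γ : ℝ → PosDefMat n) (t : ℝ) : ℝ :=
  let γ' : HermMat n := derivWithin (fun s => (γ s : HermMat n)) (Set.Icc 0 1) t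
  √(bwForm (γ t) γ' γ')

variable {γ : ℝ → PosDefMat n}

theorem continuousOn_speed (hγ : ContMDiffOn 𝓘(ℝ, ℝ) 𝓘(ℝ, HermMat n) 1 γ (Set.Icc 0 1)) :
    ContinuousOn (speed γ) (Set.Icc 0 1) := by
  have hvel := (contDiffOn_coe_opens hγ).continuousOn_derivWithin (uniqueDiffOn_Icc one_pos) le_rfl
  have hform : ContinuousOn (fun t => bwForm (γ t)) (Set.Icc 0 1) :=
    (contMDiff_bwForm (k := 0)).continuous.comp_continuousOn hγ.continuousOn
  exact ((hform.clm_apply hvel).clm_apply hvel).sqrt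

theorem pathELength_eq_integral_speed
    (hγ : ContMDiffOn 𝓘(ℝ, ℝ) 𝓘(ℝ, HermMat n) 1 γ (Set.Icc 0 1)) :
    Manifold.pathELength 𝓘(ℝ, HermMat n) γ 0 1 = ENNReal.ofReal (∫ t in 0..1, speed γ t) := by
  have hspeed (t : ℝ) (ht : t ∈ Set.Icc (0 : ℝ) 1) :
      ‖mfderivWithin 𝓘(ℝ, ℝ) 𝓘(ℝ, HermMat n) γ (Set.Icc 0 1) t (1 : ℝ)‖ₑ =
        ENNReal.ofReal (speed γ t) := by
    have hderiv := hasDerivWithinAt_coe_opens ((hγ t ht).mdifferentiableWithinAt one_ne_zero)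
    rw [enorm_tangentSpace_eq, speed, hderiv.derivWithin (uniqueDiffOn_Icc one_pos t ht)]
  rw [Manifold.pathELength_eq_lintegral_mfderivWithin_Icc]
  refine (MeasureTheory.setLIntegral_congr_fun measurableSet_Icc hspeed).trans ?_
  rw [intervalIntegral.integral_of_le zero_le_one, ← MeasureTheory.integral_Icc_eq_integral_Ioc,
    MeasureTheory.ofReal_integral_eq_lintegral_ofReal
      ((continuousOn_speed hγ).integrableOn_compact isCompact_Icc)
      (Filter.Eventually.of_forall fun _ => Real.sqrt_nonneg _)]

section Curves

attribute [local instance] frobeniusNormedRing frobeniusNormedAlgebra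

theorem speed_geodesic {N T : Matrix (Fin n) (Fin n) ℂ} (hN : N.PosDef)
    (hγ : ∀ t ∈ Set.Icc 0 1, matOf (γ t) = geodesic N T t) {t : ℝ} (ht : t ∈ Set.Icc 0 1) :
    speed γ t = √((1 - N) * T * (1 - N)).trace.re := by
  have hA := (posDef_displacement hN ht).isUnit
  have hσ : HasDerivWithinAt (fun s => (γ s : HermMat n))
      (hermPart n (geodesic N T t * momentum N t + momentum N t * geodesic N T t))
      (Set.Icc 0 1) t := by
    refine ((hermPart n).hasFDerivAt.comp_hasDerivAt t
      (hasDerivAt_geodesic hA)).hasDerivWithinAt.congr_of_mem (fun s hs => ?_) ht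
    refine toMat_injective ?_
    rw [Function.comp_apply, ← hγ s hs, toMat_hermPart (γ s).1.isHermitian]
  have hM := isHermitian_momentum hN.isHermitian hA
  have hlyap : lyapunov (γ t) (hermPart n (geodesic N T t * momentum N t +
      momentum N t * geodesic N T t)).toMat = momentum N t := by
    refine lyapunov_eq ?_
    rw [← hγ t ht, toMat_hermPart (isHermitian_anticommutator (γ t).1.isHermitian hM)]
  rw [speed, hσ.derivWithin (uniqueDiffOn_Icc one_pos t ht), bwForm_eq_re_trace, hlyap, hγ t ht,
    trace_momentum_mul_geodesic_mul_momentum hA]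

theorem exists_contMDiffOn_lift_geodesic {N T : Matrix (Fin n) (Fin n) ℂ} (hN : N.PosDef)
    (hT : T.PosDef) :
    ∃ γ : ℝ → PosDefMat n, ContMDiffOn 𝓘(ℝ, ℝ) 𝓘(ℝ, HermMat n) 1 γ (Set.Icc 0 1) ∧
      ∀ t ∈ Set.Icc 0 1, matOf (γ t) = geodesic N T t := by
  have hcoe (t : ℝ) (ht : t ∈ Set.Icc 0 1) : (hermPart n (geodesic N T t)).toMat = geodesic N T t :=
    toMat_hermPart (posDef_geodesic hN hT ht).isHermitian
  have hmem (t : ℝ) (ht : t ∈ Set.Icc 0 1) : hermPart n (geodesic N T t) ∈ PosDefMat n := by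
    change (hermPart n (geodesic N T t)).toMat.PosDef
    rw [hcoe t ht]
    exact posDef_geodesic hN hT ht
  have : Nonempty (PosDefMat n) := ⟨⟨_, hmem 1 (Set.right_mem_Icc.2 zero_le_one)⟩⟩
  obtain ⟨γ, hγ, hγσ⟩ := exists_contMDiffOn_lift_opens
    ((hermPart n).contDiff.comp (contDiff_geodesic N T)).contDiffOn hmem
  refine ⟨γ, hγ, fun t ht => ?_⟩
  rw [matOf, hγσ t ht]
  exact hcoe t ht

theorem re_trace_mul_toMat_sub_le {S : PosDefMat n} {H : HermMat n}
    {M : Matrix (Fin n) (Fin n) ℂ} (hM : M.IsHermitian) {r c : ℝ} (hr : 0 < r)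
    (hc : √(bwForm S H H) ≤ r * c) :
    (M * H.toMat).trace.re - c * (M * matOf S * M).trace.re ≤ r ^ 2 * c := by
  have hL := isHermitian_lyapunov S H.isHermitian
  have hMH := re_trace_mul_anticommutator S.1.isHermitian hM hL
  have hcs := re_trace_mul_mul_conjTranspose_le S.2.posSemidef M (lyapunov S H.toMat)
  have hpos := (S.2.posSemidef.mul_mul_conjTranspose_same M).trace_nonneg
  rw [lyapunov_spec] at hMH
  rw [hM.eq, hL.eq] at hcs
  rw [hM.eq] at hpos
  simp only [RCLike.re_eq_complex_re, ← bwForm_eq_re_trace] at hMH hcs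
  set a := (M * matOf S * M).trace.re
  have ha : √a ^ 2 = a := Real.sq_sqrt (Complex.nonneg_iff.1 hpos).1
  have hc0 : 0 ≤ c := nonneg_of_mul_nonneg_right ((Real.sqrt_nonneg _).trans hc) hr
  calc (M * H.toMat).trace.re - c * a ≤ 2 * (√a * (r * c)) - c * √a ^ 2 := by
        rw [hMH, ha]
        gcongr
        exact hcs.trans (by gcongr)
    _ = r ^ 2 * c - c * (√a - r) ^ 2 := by ring
    _ ≤ r ^ 2 * c := sub_le_self _ (by positivity)

theorem antitoneOn_calibration (hγ : ContMDiffOn 𝓘(ℝ, ℝ) 𝓘(ℝ, HermMat n) 1 γ (Set.Icc 0 1))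
    {N : Matrix (Fin n) (Fin n) ℂ} (hN : N.PosDef) {φ φ' : ℝ → ℝ} {r : ℝ} (hr : 0 < r)
    (hφ : IsClock (speed γ) r φ φ') :
    AntitoneOn (fun t => (momentum N (φ t) * matOf (γ t)).trace.re - r ^ 2 * φ t)
      (Set.Icc 0 1) := by
  have hmaps := hφ.mapsTo (fun _ => Real.sqrt_nonneg _) hr
  have hunit {t : ℝ} (ht : t ∈ Set.Ioo 0 1) : IsUnit (displacement N (φ t)) :=
    (posDef_displacement hN (hmaps (Set.Ioo_subset_Icc_self ht))).isUnit
  have hc := contDiffOn_coe_opens hγ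
  let γ' (t : ℝ) : HermMat n := derivWithin (fun s => (γ s : HermMat n)) (Set.Icc 0 1) t
  refine antitoneOn_of_hasDerivWithinAt_nonpos (convex_Icc 0 1) (f' := fun t =>
    (momentum N (φ t) * (γ' t).toMat).trace.re -
      φ' t * (momentum N (φ t) * matOf (γ t) * momentum N (φ t)).trace.re - r ^ 2 * φ' t) ?_ ?_ ?_
  · have hM := (continuousOn_momentum hN).comp hφ.continuousOn hmaps
    have hσ := (toMatL n).continuous.comp_continuousOn hc.continuousOn
    exact (Complex.continuous_re.comp_continuousOn
      (continuous_id.matrix_trace.comp_continuousOn (hM.mul hσ))).sub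
        (hφ.continuousOn.const_mul _)
  · rw [interior_Icc]
    intro t ht
    have hγ' : HasDerivAt (fun s => (γ s : HermMat n)) (γ' t) t :=
      (hc.differentiableOn one_ne_zero t (Set.Ioo_subset_Icc_self ht)).hasDerivWithinAt.hasDerivAt
        (Icc_mem_nhds ht.1 ht.2)
    have hσ := (toMatL n).hasFDerivAt.comp_hasDerivAt t hγ'
    have hφt := hφ.hasDerivAt t ht
    exact ((hasDerivAt_re_trace_momentum_mul (hunit ht) hφt hσ).sub
      (hφt.const_mul _)).hasDerivWithinAt
  · rw [interior_Icc]
    intro t ht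
    have hM := isHermitian_momentum hN.isHermitian (hunit ht)
    exact sub_nonpos.2 (re_trace_mul_toMat_sub_le hM hr (hφ.le t ht))

end Curves

theorem bwDist_le_of_isClock (hγ : ContMDiffOn 𝓘(ℝ, ℝ) 𝓘(ℝ, HermMat n) 1 γ (Set.Icc 0 1))
    {φ φ' : ℝ → ℝ} {r : ℝ} (hr : 0 < r) (hφ : IsClock (speed γ) r φ φ') :
    bwDist (γ 0) (γ 1) ≤ r := by
  have hN : (transport (matOf (γ 0)) (matOf (γ 1))).PosDef := posDef_transport (γ 0).2 (γ 1).2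
  have h := antitoneOn_calibration hγ hN hr hφ (Set.left_mem_Icc.2 zero_le_one)
    (Set.right_mem_Icc.2 zero_le_one) zero_le_one
  simp only [hφ.zero, hφ.one] at h
  have hsq : bwDist (γ 0) (γ 1) ^ 2 =
      (momentum (transport (matOf (γ 0)) (matOf (γ 1))) 1 * matOf (γ 1)).trace.re -
        (momentum (transport (matOf (γ 0)) (matOf (γ 1))) 0 * matOf (γ 0)).trace.re := by
    rw [sq_bwDist, bwSq_eq_trace, ← trace_momentum_mul_geodesic_one_sub_zero _ hN.isUnit,
      geodesic_zero, geodesic_one, transport_mul_mul_transport (γ 0).2 (γ 1).2, Complex.sub_re]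
  exact le_of_sq_le_sq (by linarith) hr.le

theorem riemannianEDist_le_bwDist (S T : PosDefMat n) :
    Manifold.riemannianEDist 𝓘(ℝ, HermMat n) S T ≤ ENNReal.ofReal (bwDist S T) := by
  have hN := posDef_transport S.2 T.2
  obtain ⟨γ, hγ, hmat⟩ := exists_contMDiffOn_lift_geodesic hN T.2
  have h0 : γ 0 = S := Subtype.ext <| toMat_injective <| by
    rw [← matOf, hmat 0 (by simp), geodesic_zero, transport_mul_mul_transport S.2 T.2]
  have h1 : γ 1 = T := Subtype.ext <| toMat_injective <| by
    rw [← matOf, hmat 1 (by simp), geodesic_one]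
  refine (Manifold.riemannianEDist_le_pathELength hγ h0 h1 zero_le_one).trans ?_
  rw [pathELength_eq_integral_speed hγ]
  have hspeed : Set.EqOn (speed γ) (fun _ => bwDist S T) (Set.uIcc 0 1) := fun t ht => by
    rw [speed_geodesic hN hmat (by simpa using ht), bwDist, bwSq_eq_trace]
  rw [intervalIntegral.integral_congr hspeed]
  simp

theorem bwDist_le_pathELength
    (hγ : ContMDiffOn 𝓘(ℝ, ℝ) 𝓘(ℝ, HermMat n) 1 γ (Set.Icc 0 1)) :
    ENNReal.ofReal (bwDist (γ 0) (γ 1)) ≤ Manifold.pathELength 𝓘(ℝ, HermMat n) γ 0 1 := by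
  rw [pathELength_eq_integral_speed hγ]
  refine ENNReal.ofReal_le_ofReal (le_of_forall_gt_imp_ge_of_dense fun r hr => ?_)
  have hr0 : 0 < r := (intervalIntegral.integral_nonneg zero_le_one fun _ _ =>
    Real.sqrt_nonneg _).trans_lt hr
  obtain ⟨φ, φ', hφ⟩ := exists_isClock (continuousOn_speed hγ) hr0 hr.le
  exact bwDist_le_of_isClock hγ hr0 hφ

theorem riemDist_bwMetric (S T : PosDefMat n) :
    riemDist (bwMetric n) S T = ENNReal.ofReal (bwDist S T) := by
  refine le_antisymm (riemannianEDist_le_bwDist S T) (le_of_forall_gt fun r hr => ?_)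
  obtain ⟨γ, rfl, rfl, hγ, hlen⟩ := Manifold.exists_lt_of_riemannianEDist_lt hr
  exact (bwDist_le_pathELength hγ).trans_lt hlen

end Distance

end BuresWasserstein

end

theorem theorem2p4 (n : ℕ) :
    (∀ S T : PosDefMat n, (bwSq S T).im = 0 ∧ 0 ≤ (bwSq S T).re) ∧
    ∃ g : ContMDiffRiemannianMetric 𝓘(ℝ, HermMat n) ∞ (HermMat n)
        (fun S : PosDefMat n => TangentSpace 𝓘(ℝ, HermMat n) S),
      (∀ (S : PosDefMat n) (H K : HermMat n),
        g.inner S H K = (lyapunov S H.toMat * (matOf S) * lyapunov S K.toMat).trace.re ∧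
        g.inner S H K = 1 / 2 * (lyapunov S H.toMat * K.toMat).trace.re) ∧
      ∀ S T : PosDefMat n, riemDist g S T = ENNReal.ofReal (bwDist S T) := by
  refine ⟨fun S T => ?_, BuresWasserstein.bwMetric n, fun S H K =>
    ⟨BuresWasserstein.bwForm_eq_re_trace S H K, BuresWasserstein.bwForm_apply S H K⟩,
    BuresWasserstein.riemDist_bwMetric⟩
  obtain ⟨hre, him⟩ := Complex.nonneg_iff.1 (BuresWasserstein.bwSq_nonneg S T)
  exact ⟨him.symm, hre⟩
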